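/- Let $(X,\|\cdot\|)$ be a reflexive real normed space, let $f:X\to\mathbb R\cup\{+\infty\}$ be proper (not identically $+\infty$) and lower semicontinuous, and let $\bar x\in X$ and $\delta\in(0,+\infty)$ be such that, with $\mathbb B(\bar x,\delta)$ the closed ball of radius $\delta$ about $\bar x$, $$x\in\mathbb B(\bar x,\delta)\setminus\{\bar x\}\quad\Longrightarrow\quad f(\bar x)<f(x).$$ Let $\lambda\in(0,+\infty)$. Then the following three statements are equivalent (the constants $\kappa$ may differ from one statement to another). (i) There exists $\kappa>0$ such that, for every continuous linear functional $\xi\in X^*$ and every $x$, $$x\in\operatorname*{argmin}_{y\in\mathbb B(\bar x,\delta)}\{f(y)-\langle\xi,y\rangle\}\quad\Longrightarrow\quad\|x-\bar x\|\le\kappa\,\|\xi\|^{\lambda}.$$ (ii) There exists $\kappa>0$ such that, for every Lipschitz function $\zeta:X\to\mathbb R$ and every $x$, $$x\in\operatorname*{argmin}_{y\in\mathbb B(\bar x,\delta)}\{f(y)+\zeta(y)\}\quad\Longrightarrow\quad\|x-\bar x\|\le\kappa\,(\operatorname{Lip}\zeta)^{\lambda},$$ where $\operatorname{Lip}\zeta=\sup_{x\ne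 y}\frac{|\zeta(x)-\zeta(y)|}{\|x-y\|}$ is the Lipschitz constant of $\zeta$, and $\zeta$ is Lipschitz if $\operatorname{Lip}\zeta<+\infty$. (iii) There exists $\kappa>0$ such that, for every convex function $\varphi:X\to\mathbb R\cup\{+\infty\}$ and every $x$, $$x\in\operatorname*{argmin}_{y\in\mathbb B(\bar x,\delta)}\{f(y)+\varphi(y)\}\quad\Longrightarrow\quad\|x-\bar x\|\le\kappa\,|\nabla\varphi|(\bar x)^{\lambda},$$ where $|\nabla\varphi|(\bar x)\in[0,+\infty]$ is the local metric slope of $\varphi$ at $\bar x$: it is $\limsup_{y\to\bar x,\,y\neq\bar x}\frac{\max\{0,\varphi(\bar x)-\varphi(y)\}}{\|\bar x-y\|}$ if $\varphi(\bar x)<+\infty$, and $+\infty$ if $\varphi(\bar x)=+\infty$ (with $(+\infty)^\lambda=+\infty$). -/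

import Mathlib

open Set Filter Topology
open scoped ENNReal

namespace TiltStability

/-- A real normed space is reflexive if the canonical embedding into its (continuous) bidual is
onto. -/
def IsReflexiveSpace (X : Type*) [NormedAddCommGroup X] [NormedSpace ℝ X] : Prop :=
  Function.Surjective (NormedSpace.inclusionInDoubleDual ℝ X)

/-- An extended-real function takes its values in `ℝ ∪ {+∞}`. -/
def NeverBot {X : Type*} (f : X → EReal) : Prop :=
  ∀ x, f x ≠ ⊥

/-- A function with values in `ℝ ∪ {+∞}` is proper if its effective domain is nonempty. -/
def IsProper {X : Type*} (f : X → EReal) : Prop :=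
  NeverBot f ∧ ∃ x, f x ≠ ⊤

/-- `argminOn g s` is the set of minimizers of `g` over `s`. -/
def argminOn {X : Type*} (g : X → EReal) (s : Set X) : Set X :=
  {x | x ∈ s ∧ ∀ y ∈ s, g x ≤ g y}

/-- Convexity of a function with values in `ℝ ∪ {+∞}`. -/
def IsConvexFun {X : Type*} [AddCommGroup X] [Module ℝ X] (φ : X → EReal) : Prop :=
  NeverBot φ ∧ ∀ x y : X, ∀ a b : ℝ, 0 < a → 0 < b → a + b = 1 →
    φ (a • x + b • y) ≤ (a : EReal) * φ x + (b : EReal) * φ y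

/-- The Lipschitz constant `sup_{x ≠ y} |ζ x - ζ y| / ‖x - y‖`, an element of `[0, +∞]`. -/
noncomputable def lipConst {X : Type*} [NormedAddCommGroup X] (ζ : X → ℝ) : ℝ≥0∞ :=
  ⨆ (x : X) (y : X) (_ : x ≠ y), ENNReal.ofReal (|ζ x - ζ y| / ‖x - y‖)

/-- A real function is Lipschitz if its Lipschitz constant is finite. -/
def IsLipschitzFun {X : Type*} [NormedAddCommGroup X] (ζ : X → ℝ) : Prop :=
  lipConst ζ < ⊤

open Classical in
/-- The local metric slope of `φ : X → ℝ ∪ {+∞}` at `x`, an element of `[0, +∞]`: it is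
`limsup_{y → x, y ≠ x} max {0, φ x - φ y} / ‖x - y‖` if `φ x` is finite, and `+∞` otherwise.
Here `EReal.toENNReal` is the positive part `t ↦ max {0, t}`. -/
noncomputable def localSlope {X : Type*} [NormedAddCommGroup X] (φ : X → EReal) (x : X) : ℝ≥0∞ :=
  if φ x = ⊤ then ⊤
  else limsup (fun y => (φ x - φ y).toENNReal / ENNReal.ofReal ‖x - y‖) (𝓝[≠] x)

end TiltStability

namespace TiltStability

variable {X : Type*} [NormedAddCommGroup X] [NormedSpace ℝ X]

/-! Linear tilts are special Lipschitz and convex perturbations (of constant and slope at most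
`‖ξ‖`), so (ii) and (iii) each give (i). Conversely, a minimizer `x` of `f + ζ` or `f + φ` satisfies
`f x ≤ f xbar + L * ‖x - xbar‖`, with `L` the Lipschitz constant or the slope; convexity turns the
local slope into a bound on the whole ball. `norm_sub_le_of_tilt_stable` turns this inequality and
(i) into the estimate: if the tilt by `ξ` has a minimizer `z`, comparing `z` with `x` and using `f
xbar ≤ f z` gives `ξ (x - xbar) - (f x - f xbar) ≤ κ * ‖ξ‖ ^ (1 + lam)`. By Stegall's principle
(`exists_argminOn_near`) such `ξ` are dense, so this holds for all `ξ`, and a multiple of a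
functional norming `x - xbar` finishes.

Stegall's principle rests on `exists_small_slice`. If all slices over an open set were wide, a
separable closed subspace `Y` of the dual would contain functionals witnessing this. On `Y`
countably many points approximate all subgradients of the conjugate, so Baire makes the conjugate
nearly affine somewhere, which forces thin slices. -/

/-- The conjugate of a real function `F` restricted to the set `s`. -/
noncomputable def conjOn (s : Set X) (F : X → ℝ) (ξ : StrongDual ℝ X) : ℝ :=
  ⨆ x : s, (ξ x - F x)

/-! ### Duality in reflexive spaces -/

/-- A point outside the closure of a subspace is separated from it by a functional. -/
theorem exists_dual_vanishing {E : Type*} [NormedAddCommGroup E] [NormedSpace ℝ E]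
    (M : Submodule ℝ E) {x : E} (hx : x ∉ closure (M : Set E)) :
    ∃ g : StrongDual ℝ E, g x ≠ 0 ∧ ∀ y ∈ M, g y = 0 := by
  obtain ⟨g, u, hgu, hux⟩ := geometric_hahn_banach_closed_point
    (M.convex.closure) isClosed_closure hx
  have h0 : 0 < u := by simpa using hgu 0 (subset_closure M.zero_mem)
  refine ⟨g, (h0.trans hux).ne', fun y hy => ?_⟩
  by_contra hne
  have := hgu _ (subset_closure (M.smul_mem (u / g y) hy))
  rw [map_smul, smul_eq_mul, div_mul_cancel₀ _ hne] at this
  exact lt_irrefl _ this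

theorem IsReflexiveSpace.exists_eq (hX : IsReflexiveSpace X)
    (Λ : StrongDual ℝ (StrongDual ℝ X)) : ∃ x : X, ∀ ξ : StrongDual ℝ X, Λ ξ = ξ x := by
  obtain ⟨x, rfl⟩ := hX Λ
  exact ⟨x, fun ξ => rfl⟩

theorem IsReflexiveSpace.completeSpace (hX : IsReflexiveSpace X) : CompleteSpace X :=
  ((NormedSpace.inclusionInDoubleDualLi (E := X) ℝ).isometry.isUniformInducing.completeSpace_congr
    hX).2 inferInstance

/-- Bounded sequences in a reflexive space converge weakly along an ultrafilter. -/
theorem IsReflexiveSpace.exists_weak_limit (hX : IsReflexiveSpace X) (u : ℕ → X) (R : ℝ)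
    (hu : ∀ n, ‖u n‖ ≤ R) :
    ∃ (x : X) (l : Ultrafilter ℕ), (l : Filter ℕ) ≤ atTop ∧
      ∀ ξ : StrongDual ℝ X, Tendsto (fun n => ξ (u n)) l (𝓝 (ξ x)) := by
  have hc := WeakDual.isCompact_closedBall (𝕜 := ℝ) (0 : StrongDual ℝ (StrongDual ℝ X)) R
  let v : ℕ → WeakDual ℝ (StrongDual ℝ X) := fun n =>
    StrongDual.toWeakDual (NormedSpace.inclusionInDoubleDual ℝ X (u n))
  let l : Ultrafilter ℕ := Ultrafilter.of atTop
  obtain ⟨Λ, -, hΛ⟩ := hc.ultrafilter_le_nhds (l.map v) (by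
    rw [le_principal_iff]
    refine Filter.mem_map.2 (Filter.univ_mem' fun n => ?_)
    simp only [mem_preimage, Metric.mem_closedBall, dist_zero_right]
    exact (NormedSpace.double_dual_bound ℝ X (u n)).trans (hu n))
  obtain ⟨x, hx⟩ := hX.exists_eq (WeakDual.toStrongDual Λ)
  refine ⟨x, l, Ultrafilter.of_le _, fun ξ => ?_⟩
  rw [← hx ξ]
  have h1 : Tendsto v l (𝓝 Λ) := hΛ
  exact ((WeakDual.eval_continuous ξ).tendsto Λ).comp h1

/-- If `X₀` separates the points of the closed subspace `Y` of the dual of a reflexive space,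
then `X₀` and the annihilator of `Y` span a dense subspace. -/
theorem IsReflexiveSpace.exists_approx (hX : IsReflexiveSpace X)
    (Y : Submodule ℝ (StrongDual ℝ X)) (hY : IsClosed (Y : Set (StrongDual ℝ X)))
    (X₀ : Submodule ℝ X) (hsep : ∀ y ∈ Y, (∀ x ∈ X₀, y x = 0) → y = 0) (x : X) {r : ℝ}
    (hr : 0 < r) : ∃ c ∈ X₀, ∀ y ∈ Y, |y (x - c)| ≤ r * ‖y‖ := by
  let Z : Submodule ℝ X :=
    { carrier := {x | ∀ y ∈ Y, y x = 0}
      add_mem' := fun {a b} ha hb y hy => by rw [map_add, ha y hy, hb y hy, add_zero]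
      zero_mem' := fun y _ => map_zero y
      smul_mem' := fun t a ha y hy => by rw [map_smul, ha y hy, smul_zero] }
  have hdense : x ∈ closure ((X₀ ⊔ Z : Submodule ℝ X) : Set X) := by
    by_contra hx
    obtain ⟨g, hgx, hg⟩ := exists_dual_vanishing _ hx
    -- By reflexivity a functional on the dual that vanishes on `Y` is evaluation at a point of `Z`,
    -- where `g` vanishes; so nothing separates `g` from `Y`.
    have hgY : g ∈ Y := by
      by_contra hgY
      rw [← SetLike.mem_coe, ← hY.closure_eq] at hgY
      obtain ⟨Λ, hΛg, hΛ⟩ := exists_dual_vanishing Y hgY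
      obtain ⟨z, hz⟩ := hX.exists_eq Λ
      refine hΛg ?_
      rw [hz]
      exact hg z (Submodule.mem_sup_right fun y hy => by rw [← hz, hΛ y hy])
    refine hgx ?_
    rw [hsep g hgY fun z hz => hg z (Submodule.mem_sup_left hz)]
    rfl
  obtain ⟨w, hw, hxw⟩ := Metric.mem_closure_iff.1 hdense r hr
  obtain ⟨c, hc, z, hz, rfl⟩ := Submodule.mem_sup.1 hw
  refine ⟨c, hc, fun y hy => ?_⟩
  have h1 : y (x - c) = y (x - (c + z)) := by
    have := hz y hy
    simp only [map_sub, map_add, this, add_zero]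
  rw [h1]
  calc |y (x - (c + z))| ≤ ‖y‖ * ‖x - (c + z)‖ := y.le_opNorm _
    _ ≤ ‖y‖ * r := by
        gcongr
        rw [← dist_eq_norm]; exact hxw.le
    _ = r * ‖y‖ := mul_comm _ _

/-! ### Conjugates over bounded sets -/

section Conjugate

variable {s : Set X} {F : X → ℝ} {R m : ℝ}

theorem bddAbove_range_conjOn (hs : ∀ x ∈ s, ‖x‖ ≤ R) (hF : ∀ x ∈ s, m ≤ F x)
    (ξ : StrongDual ℝ X) : BddAbove (range fun x : s => ξ x - F x) := by
  refine ⟨‖ξ‖ * R - m, ?_⟩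
  rintro _ ⟨x, rfl⟩
  have h1 : ξ x ≤ ‖ξ‖ * R := ((le_abs_self _).trans (ξ.le_opNorm _)).trans
    (mul_le_mul_of_nonneg_left (hs x x.2) (norm_nonneg _))
  have := hF x x.2
  simp only
  linarith

theorem le_conjOn (hs : ∀ x ∈ s, ‖x‖ ≤ R) (hF : ∀ x ∈ s, m ≤ F x) (ξ : StrongDual ℝ X) {x : X}
    (hx : x ∈ s) : ξ x - F x ≤ conjOn s F ξ :=
  le_ciSup (bddAbove_range_conjOn hs hF ξ) (⟨x, hx⟩ : s)

theorem exists_conjOn_sub_lt (hne : s.Nonempty) (ξ : StrongDual ℝ X) {α : ℝ} (hα : 0 < α) :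
    ∃ x ∈ s, conjOn s F ξ - α < ξ x - F x := by
  have : Nonempty s := hne.to_subtype
  obtain ⟨x, hx⟩ := exists_lt_of_lt_ciSup
    (show conjOn s F ξ - α < ⨆ x : s, (ξ x - F x) from sub_lt_self _ hα)
  exact ⟨x, x.2, hx⟩

theorem conjOn_le_add (hne : s.Nonempty) (hs : ∀ x ∈ s, ‖x‖ ≤ R) (hF : ∀ x ∈ s, m ≤ F x)
    (ξ η : StrongDual ℝ X) : conjOn s F ξ ≤ conjOn s F η + R * ‖ξ - η‖ := by
  have : Nonempty s := hne.to_subtype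
  refine ciSup_le fun x => ?_
  have h1 := le_conjOn hs hF η x.2
  have h2 : (ξ - η) x ≤ ‖ξ - η‖ * R := ((le_abs_self _).trans ((ξ - η).le_opNorm _)).trans
    (mul_le_mul_of_nonneg_left (hs x x.2) (norm_nonneg _))
  rw [sub_apply] at h2
  linarith

theorem continuous_conjOn (hne : s.Nonempty) (hs : ∀ x ∈ s, ‖x‖ ≤ R) (hF : ∀ x ∈ s, m ≤ F x) :
    Continuous (conjOn s F) := by
  have hR : 0 ≤ R := (norm_nonneg _).trans (hs _ hne.some_mem)
  refine (LipschitzWith.of_le_add_mul ⟨R, hR⟩ fun ξ η => ?_).continuous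
  rw [dist_eq_norm]
  exact conjOn_le_add hne hs hF ξ η

/-- In a reflexive space the conjugate has subgradients in the space itself. -/
theorem exists_subgradient_conjOn (hX : IsReflexiveSpace X) (hne : s.Nonempty)
    (hs : ∀ x ∈ s, ‖x‖ ≤ R) (hF : ∀ x ∈ s, m ≤ F x) (ξ : StrongDual ℝ X) :
    ∃ x : X, ∀ η, conjOn s F ξ + (η - ξ) x ≤ conjOn s F η := by
  choose u hus hu using fun n : ℕ =>
    exists_conjOn_sub_lt (F := F) hne ξ (Nat.one_div_pos_of_nat (α := ℝ) (n := n))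
  -- A weak limit of almost maximizers is a subgradient, even if it lies outside `s`.
  obtain ⟨x, l, hl, hx⟩ := hX.exists_weak_limit u R fun n => hs _ (hus n)
  refine ⟨x, fun η => ?_⟩
  have h1 : Tendsto (fun n : ℕ => conjOn s F ξ + (η - ξ) (u n) - 1 / ((n : ℝ) + 1)) l
      (𝓝 (conjOn s F ξ + (η - ξ) x - 0)) :=
    ((hx (η - ξ)).const_add _).sub (tendsto_one_div_add_atTop_nhds_zero_nat.mono_left hl)
  rw [sub_zero] at h1
  refine le_of_tendsto h1 (Eventually.of_forall fun n => ?_)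
  have h2 := hu n
  have h3 := le_conjOn hs hF η (hus n)
  rw [sub_apply]
  linarith

end Conjugate

/-! ### Small slices by separable reduction -/

/-- A countable set is contained in a countable set whose closure is a subspace and which is stable
under countably many prescribed operations. -/
theorem exists_countable_invariant {E : Type*} [NormedAddCommGroup E] [NormedSpace ℝ E] (a : E)
    (w : E → ℕ → E) : ∃ (C : Set E) (Y : Submodule ℝ E), C.Countable ∧ a ∈ C ∧
      (∀ y ∈ C, ∀ n, w y n ∈ C) ∧ (Y : Set E) = closure C := by
  -- Rational scalars keep the set countable; real ones are recovered in the closure.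
  let Φ : Set E → Set E := fun A =>
    A ∪ (image2 (fun x y => x + y) A A ∪ (image2 (fun (q : ℚ) x => (q : ℝ) • x) univ A ∪
      image2 w A univ))
  let A : ℕ → Set E := fun n => Φ^[n] {a}
  have hA : ∀ n, A (n + 1) = Φ (A n) := fun n => Function.iterate_succ_apply' Φ n {a}
  have hmono : Monotone A := monotone_nat_of_le_succ fun n => by
    rw [hA]; exact subset_union_left
  have hcount : ∀ n, (A n).Countable := fun n => by
    induction n with
    | zero => exact countable_singleton a
    | succ n ih =>
      rw [hA]
      exact ih.union ((ih.image2 ih _).union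
        ((countable_univ.image2 ih _).union (ih.image2 countable_univ _)))
  let C : Set E := ⋃ n, A n
  have hadd : ∀ x ∈ C, ∀ y ∈ C, x + y ∈ C := by
    intro x hx y hy
    obtain ⟨i, hi⟩ := mem_iUnion.1 hx
    obtain ⟨j, hj⟩ := mem_iUnion.1 hy
    refine mem_iUnion.2 ⟨max i j + 1, ?_⟩
    rw [hA]
    exact Or.inr (Or.inl (mem_image2_of_mem (hmono (le_max_left i j) hi)
      (hmono (le_max_right i j) hj)))
  have hsmul : ∀ (q : ℚ), ∀ x ∈ C, (q : ℝ) • x ∈ C := by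
    intro q x hx
    obtain ⟨i, hi⟩ := mem_iUnion.1 hx
    refine mem_iUnion.2 ⟨i + 1, ?_⟩
    rw [hA]
    exact Or.inr (Or.inr (Or.inl (mem_image2_of_mem (mem_univ q) hi)))
  have haC : a ∈ C := mem_iUnion.2 ⟨0, rfl⟩
  refine ⟨C, ⟨⟨⟨closure C, ?_⟩, ?_⟩, ?_⟩, countable_iUnion hcount, haC, ?_, rfl⟩
  · intro x y hx hy
    exact map_mem_closure₂ continuous_add hx hy hadd
  · have := hsmul 0 a haC
    rw [Rat.cast_zero, zero_smul] at this
    exact subset_closure this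
  · intro t x hx
    refine map_mem_closure₂ (s := range ((↑) : ℚ → ℝ)) (f := fun (t : ℝ) (x : E) => t • x)
      continuous_smul (Rat.denseRange_cast t) hx ?_
    rintro _ ⟨q, rfl⟩ y hy
    exact hsmul q y hy
  · intro y hy n
    obtain ⟨i, hi⟩ := mem_iUnion.1 hy
    refine mem_iUnion.2 ⟨i + 1, ?_⟩
    rw [hA]
    exact Or.inr (Or.inr (Or.inr (mem_image2_of_mem hi (mem_univ n))))

/-- In a reflexive space, arbitrarily small linear tilts of a function bounded below on a bounded
set have slices of arbitrarily small diameter. -/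
theorem exists_small_slice (hX : IsReflexiveSpace X) {s : Set X} {F : X → ℝ} {R m : ℝ}
    (hne : s.Nonempty) (hs : ∀ x ∈ s, ‖x‖ ≤ R) (hF : ∀ x ∈ s, m ≤ F x)
    {U : Set (StrongDual ℝ X)} (hU : IsOpen U) (hUne : U.Nonempty) {ε : ℝ} (hε : 0 < ε) :
    ∃ ξ ∈ U, ∃ α : ℝ, 0 < α ∧ ∀ x ∈ s, ∀ x' ∈ s, conjOn s F ξ - α ≤ ξ x - F x →
      conjOn s F ξ - α ≤ ξ x' - F x' → ‖x - x'‖ ≤ ε := by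
  by_contra! hcon
  -- `v` norms the difference of two distant points of the slice of depth `1 / (n + 1)`. Stability
  -- of `C` under `w` puts these functionals in `Y`.
  have hw : ∀ (ξ : StrongDual ℝ X) (n : ℕ), ∃ v : StrongDual ℝ X, ξ ∈ U → ‖v‖ ≤ 1 ∧
      ∃ x ∈ s, ∃ x' ∈ s, conjOn s F ξ - 1 / ((n : ℝ) + 1) ≤ ξ x - F x ∧
        conjOn s F ξ - 1 / ((n : ℝ) + 1) ≤ ξ x' - F x' ∧ ε < v (x - x') := by
    intro ξ n
    by_cases hξ : ξ ∈ U
    · obtain ⟨x, hx, x', hx', h1, h2, h3⟩ := hcon ξ hξ _ (Nat.one_div_pos_of_nat (n := n))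
      obtain ⟨v, hv, hvx⟩ := exists_dual_vector'' ℝ (x - x')
      exact ⟨v, fun _ => ⟨hv, x, hx, x', hx', h1, h2, by rw [hvx]; exact h3⟩⟩
    · exact ⟨0, fun h => absurd h hξ⟩
  choose w hw using hw
  obtain ⟨ξ₀, hξ₀⟩ := hUne
  obtain ⟨C, Y, hCc, hξ₀C, hCw, hYC⟩ := exists_countable_invariant ξ₀ w
  have hCY : C ⊆ Y := by rw [hYC]; exact subset_closure
  have hYclosed : IsClosed (Y : Set (StrongDual ℝ X)) := by rw [hYC]; exact isClosed_closure
  -- a separable subspace of `X` separating the points of `Y`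
  have hnorming : ∀ y : StrongDual ℝ X, ∃ x : X, ‖x‖ ≤ 1 ∧ ‖y‖ ≤ 2 * |y x| := by
    intro y
    rcases eq_or_ne y 0 with rfl | hy
    · exact ⟨0, by simp, by simp⟩
    · have hy' : 0 < ‖y‖ := norm_pos_iff.2 hy
      obtain ⟨x, hx1, hx2⟩ := y.exists_lt_apply_of_lt_opNorm (half_lt_self hy')
      rw [Real.norm_eq_abs] at hx2
      exact ⟨x, hx1.le, by linarith⟩
  choose p hp1 hp2 using hnorming
  let X₀ : Submodule ℝ X := Submodule.span ℝ (p '' C)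
  have hsep : ∀ y ∈ Y, (∀ x ∈ X₀, y x = 0) → y = 0 := by
    intro y hy hyx
    rw [← norm_le_zero_iff]
    refine le_of_forall_pos_le_add fun e he => ?_
    rw [← SetLike.mem_coe, hYC] at hy
    -- `e / 3`: as `y (p z) = 0`, `‖z‖ ≤ 2 * ‖y - z‖`, hence `‖y‖ ≤ 3 * ‖y - z‖`.
    obtain ⟨z, hz, hyz⟩ := Metric.mem_closure_iff.1 hy (e / 3) (by positivity)
    rw [dist_eq_norm] at hyz
    have h1 : y (p z) = 0 := hyx _ (Submodule.subset_span (mem_image_of_mem p hz))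
    have h2 : |(y - z) (p z)| ≤ ‖y - z‖ := by
      have := (y - z).le_opNorm (p z)
      exact this.trans (mul_le_of_le_one_right (norm_nonneg _) (hp1 z))
    rw [sub_apply, h1, zero_sub, abs_neg] at h2
    have h3 := hp2 z
    have h4 : ‖y‖ ≤ ‖y - z‖ + ‖z‖ := by simpa using norm_add_le (y - z) z
    linarith
  obtain ⟨K, hKc, hK⟩ := (hCc.image p).isSeparable.span (R := ℝ)
  have happrox : ∀ x : X, ∃ c ∈ K, ∀ y ∈ Y, |y (x - c)| ≤ ε / 4 * ‖y‖ := by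
    intro x
    obtain ⟨c', hc', h1⟩ := hX.exists_approx Y hYclosed X₀ hsep x (r := ε / 8) (by positivity)
    obtain ⟨c, hc, h2⟩ := Metric.mem_closure_iff.1 (hK hc') (ε / 8) (by positivity)
    rw [dist_eq_norm] at h2
    refine ⟨c, hc, fun y hy => ?_⟩
    have h3 : |y (c' - c)| ≤ ‖y‖ * (ε / 8) :=
      (y.le_opNorm _).trans (mul_le_mul_of_nonneg_left h2.le (norm_nonneg _))
    have h4 : y (x - c) = y (x - c') + y (c' - c) := by rw [← map_add]; congr 1; abel
    rw [h4]
    have := abs_add_le (y (x - c')) (y (c' - c))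
    have := h1 y hy
    linarith
  have hcont := continuous_conjOn hne hs hF
  -- Baire category in `Y`
  let T : X → Set Y := fun c => {ξ | ∀ η : Y, conjOn s F ξ + ((η : StrongDual ℝ X) - ξ) c
      - ε / 4 * ‖(η : StrongDual ℝ X) - ξ‖ ≤ conjOn s F η}
  have hTclosed : ∀ c ∈ K, IsClosed (T c) := by
    intro c _
    simp only [T, ofPred_forall]
    refine isClosed_iInter fun η => isClosed_le ?_ continuous_const
    have h1 : Continuous fun ξ : Y => ((η : StrongDual ℝ X) - ξ) :=
      continuous_const.sub continuous_subtype_val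
    exact ((hcont.comp continuous_subtype_val).add (h1.clm_apply continuous_const)).sub
      (continuous_const.mul h1.norm)
  have hTcover : ⋃ c ∈ K, T c = univ := by
    refine eq_univ_of_forall fun ξ => ?_
    obtain ⟨x, hx⟩ := exists_subgradient_conjOn hX hne hs hF (ξ : StrongDual ℝ X)
    obtain ⟨c, hc, h⟩ := happrox x
    refine mem_biUnion hc fun η => ?_
    have h1 := hx η
    have h2 := (abs_le.1 (h _ (Y.sub_mem η.2 ξ.2))).1
    rw [map_sub] at h2
    linarith
  have : TopologicalSpace.IsCompletelyPseudoMetrizableSpace Y :=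
    hYclosed.isClosedEmbedding_subtypeVal.IsCompletelyPseudoMetrizableSpace
  have : BaireSpace Y := BaireSpace.of_completelyPseudoMetrizable
  have hdense := dense_biUnion_interior_of_closed hTclosed hKc hTcover
  obtain ⟨ξ₁, hξ₁U, hξ₁⟩ := hdense.inter_open_nonempty (Subtype.val ⁻¹' U)
    (hU.preimage continuous_subtype_val) ⟨⟨ξ₀, hCY hξ₀C⟩, mem_preimage.2 hξ₀⟩
  obtain ⟨c, hc, hξ₁⟩ := mem_iUnion₂.1 hξ₁
  obtain ⟨ρ, hρ, hball⟩ := Metric.isOpen_iff.1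
    ((hU.preimage continuous_subtype_val).inter (isOpen_interior (s := T c))) ξ₁ ⟨hξ₁U, hξ₁⟩
  have hξ₁C : (ξ₁ : StrongDual ℝ X) ∈ closure C := by rw [← hYC]; exact ξ₁.2
  -- The base point must lie in `C` itself, since only there is `w ξ n` known to be in `Y`.
  obtain ⟨ξ, hξC, hξd⟩ := Metric.mem_closure_iff.1 hξ₁C (ρ / 2) (by positivity)
  have hξU : ξ ∈ U := (hball (show (⟨ξ, hCY hξC⟩ : Y) ∈ Metric.ball ξ₁ ρ by
    rw [Metric.mem_ball, dist_comm, Subtype.dist_eq]; linarith)).1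
  -- the conjugate is almost affine around `ξ`
  have hup : ∀ v ∈ Y, ‖v‖ ≤ ρ / 4 → conjOn s F (ξ + v) ≤ conjOn s F ξ + v c + ε / 4 * ‖v‖ := by
    intro v hv hvn
    have hη : (⟨ξ + v, Y.add_mem (hCY hξC) hv⟩ : Y) ∈ T c := by
      refine interior_subset (hball ?_).2
      rw [Metric.mem_ball, Subtype.dist_eq]
      calc dist (ξ + v) (ξ₁ : StrongDual ℝ X)
          ≤ dist (ξ + v) ξ + dist ξ (ξ₁ : StrongDual ℝ X) := dist_triangle _ _ _
        _ < ρ := by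
          rw [dist_comm ξ, dist_eq_norm, add_sub_cancel_left]
          linarith
    -- The subgradient inequality based at `ξ + v`, tested at `ξ`, is an upper bound for the
    -- conjugate at `ξ + v`.
    have h := hη ⟨ξ, hCY hξC⟩
    simp only [sub_add_cancel_left, norm_neg] at h
    rw [neg_apply] at h
    linarith
  have hslice : ∀ n : ℕ, ∀ x ∈ s, conjOn s F ξ - 1 / ((n : ℝ) + 1) ≤ ξ x - F x →
      ∀ v ∈ Y, ‖v‖ ≤ 1 → v (x - c) ≤ ε / 4 + 1 / ((n : ℝ) + 1) / (ρ / 4) := by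
    intro n x hx hxn v hv hv1
    have hn : ‖(ρ / 4) • v‖ ≤ ρ / 4 := by
      rw [norm_smul, Real.norm_of_nonneg (by positivity)]
      exact mul_le_of_le_one_right (by positivity) hv1
    have h1 := hup _ (Y.smul_mem (ρ / 4) hv) hn
    have h2 := le_conjOn hs hF (ξ + (ρ / 4) • v) hx
    rw [add_apply, smul_apply, smul_eq_mul] at h2
    rw [smul_apply, smul_eq_mul] at h1
    have h3 : ε / 4 * ‖(ρ / 4) • v‖ ≤ ε / 4 * (ρ / 4) := by gcongr
    have h4 : v (x - c) * (ρ / 4) ≤ ε / 4 * (ρ / 4) + 1 / ((n : ℝ) + 1) := by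
      rw [map_sub]; linarith
    rw [← sub_le_iff_le_add', le_div_iff₀ (by positivity)]
    linarith
  -- At this depth both slice points are within `ε / 2` of `c` as seen by `w ξ n`, so it cannot
  -- separate them by more than `ε`.
  obtain ⟨n, hn⟩ := exists_nat_one_div_lt (show 0 < ε / 4 * (ρ / 4) by positivity)
  obtain ⟨hv, x, hx, x', hx', h1, h2, h3⟩ := hw ξ n hξU
  have hvY := hCY (hCw ξ hξC n)
  have h4 := hslice n x hx h1 _ hvY hv
  have h5 := hslice n x' hx' h2 _ (Y.neg_mem hvY) (by rwa [norm_neg])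
  rw [neg_apply] at h5
  have h6 : 1 / ((n : ℝ) + 1) / (ρ / 4) < ε / 4 := by
    rwa [div_lt_iff₀ (by positivity)]
  rw [map_sub] at h3 h4 h5
  linarith

/-! ### Stegall's variational principle -/

/-- **Stegall's variational principle** in a reflexive space: a lower semicontinuous function bounded
below on a closed bounded set attains its minimum there after an arbitrarily small linear tilt. -/
theorem exists_argminOn_near (hX : IsReflexiveSpace X) {f : X → EReal} (hbot : NeverBot f)
    (hlsc : LowerSemicontinuous f) {B : Set X} (hB : IsClosed B) {R m : ℝ}
    (hBR : ∀ x ∈ B, ‖x‖ ≤ R) (hm : ∀ x ∈ B, (m : EReal) ≤ f x) (hne : ∃ x ∈ B, f x ≠ ⊤)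
    (ξ₀ : StrongDual ℝ X) {ε : ℝ} (hε : 0 < ε) :
    ∃ ξ : StrongDual ℝ X, ‖ξ - ξ₀‖ < ε ∧
      (argminOn (fun y => f y - ((ξ y : ℝ) : EReal)) B).Nonempty := by
  have := hX.completeSpace
  let s : Set X := {x | x ∈ B ∧ f x ≠ ⊤}
  let F : X → ℝ := fun x => (f x).toReal
  have hfF : ∀ x ∈ s, f x = F x := fun x hx => (EReal.coe_toReal hx.2 (hbot x)).symm
  have hsne : s.Nonempty := hne
  have hs : ∀ x ∈ s, ‖x‖ ≤ R := fun x hx => hBR x hx.1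
  have hF : ∀ x ∈ s, m ≤ F x := fun x hx => by
    have := hm x hx.1
    rwa [hfF x hx, EReal.coe_le_coe_iff] at this
  have hR : 0 ≤ R := (norm_nonneg _).trans (hs _ hsne.some_mem)
  let G : ℕ → Set (StrongDual ℝ X) := fun n => {ξ | ∃ α : ℝ, 0 < α ∧ ∀ x ∈ s, ∀ x' ∈ s,
    conjOn s F ξ - α ≤ ξ x - F x → conjOn s F ξ - α ≤ ξ x' - F x' →
      ‖x - x'‖ ≤ 1 / ((n : ℝ) + 1)}
  have hGopen : ∀ n, IsOpen (G n) := by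
    intro n
    -- Conjugate and linear term each move by at most `α / 4`, so the slice of depth `α / 2` at `η`
    -- lies in that of depth `α` at `ξ`; `R + 1` covers `R = 0`.
    refine Metric.isOpen_iff.2 fun ξ ⟨α, hα, h⟩ => ⟨α / (4 * (R + 1)), by positivity, ?_⟩
    intro η hη
    rw [Metric.mem_ball, dist_eq_norm, lt_div_iff₀ (by positivity)] at hη
    have hd : R * ‖η - ξ‖ ≤ α / 4 := by
      have := norm_nonneg (η - ξ)
      linarith
    have key : ∀ x ∈ s, conjOn s F η - α / 2 ≤ η x - F x → conjOn s F ξ - α ≤ ξ x - F x := by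
      intro x hx hxη
      have h1 := conjOn_le_add hsne hs hF ξ η
      rw [norm_sub_rev] at h1
      have h2 : (η - ξ) x ≤ ‖η - ξ‖ * R := ((le_abs_self _).trans ((η - ξ).le_opNorm _)).trans
        (mul_le_mul_of_nonneg_left (hs x hx) (norm_nonneg _))
      rw [sub_apply] at h2
      linarith
    exact ⟨α / 2, by positivity, fun x hx x' hx' hxη hxη' =>
      h x hx x' hx' (key x hx hxη) (key x' hx' hxη')⟩
  have hGdense : ∀ n, Dense (G n) := by
    intro n
    refine dense_iff_inter_open.2 fun U hU hUne => ?_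
    obtain ⟨ξ, hξU, hξ⟩ := exists_small_slice hX hsne hs hF hU hUne
      (Nat.one_div_pos_of_nat (α := ℝ) (n := n))
    exact ⟨ξ, hξU, hξ⟩
  have : BaireSpace (StrongDual ℝ X) := BaireSpace.of_completelyPseudoMetrizable
  obtain ⟨ξ, hξ, hξε⟩ := (dense_iInter_of_isOpen_nat hGopen hGdense).exists_dist_lt ξ₀ hε
  rw [dist_comm, dist_eq_norm] at hξε
  refine ⟨ξ, hξε, ?_⟩
  choose u hus hu using fun n : ℕ =>
    exists_conjOn_sub_lt (F := F) hsne ξ (Nat.one_div_pos_of_nat (α := ℝ) (n := n))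
  have hcauchy : CauchySeq u := by
    refine Metric.cauchySeq_iff.2 fun e he => ?_
    obtain ⟨k, hk⟩ := exists_nat_one_div_lt he
    obtain ⟨α, hα, h⟩ := mem_iInter.1 hξ k
    obtain ⟨N, hN⟩ := exists_nat_one_div_lt hα
    have hsl : ∀ n ≥ N, conjOn s F ξ - α ≤ ξ (u n) - F (u n) := fun n hn => by
      have h1 : 1 / ((n : ℝ) + 1) ≤ 1 / ((N : ℝ) + 1) := Nat.one_div_le_one_div hn
      linarith [hu n]
    refine ⟨N, fun i hi j hj => ?_⟩
    rw [dist_eq_norm]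
    exact (h _ (hus i) _ (hus j) (hsl i hi) (hsl j hj)).trans_lt hk
  obtain ⟨x, hx⟩ := cauchySeq_tendsto_of_complete hcauchy
  have hxB : x ∈ B := hB.mem_of_tendsto hx (Eventually.of_forall fun n => (hus n).1)
  refine ⟨x, hxB, fun y hy => ?_⟩
  by_cases hyt : f y = ⊤
  · simp only [hyt, EReal.top_sub_coe, le_top]
  have hys : y ∈ s := ⟨hy, hyt⟩
  have hfx : f x ≤ ((F y - ξ y + ξ x : ℝ) : EReal) := by
    by_contra! hlt
    obtain ⟨c, hc1, hc2⟩ := EReal.lt_iff_exists_real_btwn.1 hlt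
    rw [EReal.coe_lt_coe_iff] at hc1
    have h1 : ∀ᶠ n in atTop, (c : EReal) < f (u n) := hx.eventually (hlsc x c hc2)
    have h2 : Tendsto (fun n : ℕ => ξ (u n) - ξ y + F y + 1 / ((n : ℝ) + 1)) atTop
        (𝓝 (ξ x - ξ y + F y + 0)) :=
      ((((ξ.continuous.tendsto x).comp hx).sub_const _).add_const _).add
        tendsto_one_div_add_atTop_nhds_zero_nat
    have h3 := h2.eventually (gt_mem_nhds (show ξ x - ξ y + F y + 0 < c by linarith))
    obtain ⟨n, hn1, hn2⟩ := (h1.and h3).exists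
    rw [hfF _ (hus n), EReal.coe_lt_coe_iff] at hn1
    have h4 := hu n
    have h5 := le_conjOn hs hF ξ hys
    linarith
  have hxt : f x ≠ ⊤ := (hfx.trans_lt (EReal.coe_lt_top _)).ne
  have hxs : x ∈ s := ⟨hxB, hxt⟩
  simp only
  rw [hfF x hxs, EReal.coe_le_coe_iff] at hfx
  rw [hfF x hxs, hfF y hys, ← EReal.coe_sub, ← EReal.coe_sub, EReal.coe_le_coe_iff]
  linarith

/-! ### From tilt stability to growth -/

/-- Stability of the minimizers under linear tilts forces growth of `f` at the reference point. -/
theorem norm_sub_le_of_tilt_stable (hX : IsReflexiveSpace X) {f : X → EReal} (hbot : NeverBot f)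
    (hlsc : LowerSemicontinuous f) {xbar : X} {δ : ℝ} (hδ : 0 < δ)
    (hfin : f xbar ≠ ⊤) (hmin : ∀ x ∈ Metric.closedBall xbar δ \ {xbar}, f xbar < f x)
    {lam κ : ℝ} (hlam : 0 < lam) (hκ : 0 < κ)
    (htilt : ∀ (ξ : StrongDual ℝ X) (x : X),
      x ∈ argminOn (fun y => f y - ((ξ y : ℝ) : EReal)) (Metric.closedBall xbar δ) →
        ‖x - xbar‖ ≤ κ * ‖ξ‖ ^ lam)
    {x : X} (hx : x ∈ Metric.closedBall xbar δ) {L : ℝ} (hL : 0 ≤ L)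
    (hfx : f x ≤ f xbar + ((L * ‖x - xbar‖ : ℝ) : EReal)) :
    ‖x - xbar‖ ≤ 2 ^ (1 + lam) * κ * L ^ lam := by
  have hxbar : xbar ∈ Metric.closedBall xbar δ := Metric.mem_closedBall_self hδ.le
  obtain ⟨m, hm⟩ : ∃ m : ℝ, f xbar = m := ⟨_, (EReal.coe_toReal hfin (hbot xbar)).symm⟩
  rcases eq_or_ne x xbar with rfl | hne
  · rw [sub_self, norm_zero]
    positivity
  have hd : 0 < ‖x - xbar‖ := norm_pos_iff.2 (sub_ne_zero.2 hne)
  have hfxt : f x ≠ ⊤ := by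
    rw [hm, ← EReal.coe_add] at hfx
    exact (hfx.trans_lt (EReal.coe_lt_top _)).ne
  obtain ⟨a, ha⟩ : ∃ a : ℝ, f x = a := ⟨_, (EReal.coe_toReal hfxt (hbot x)).symm⟩
  have hlt := hmin x ⟨hx, hne⟩
  rw [hm, ha, EReal.coe_lt_coe_iff] at hlt
  rw [hm, ha, ← EReal.coe_add, EReal.coe_le_coe_iff] at hfx
  have hLpos : 0 < L := by
    rcases hL.eq_or_lt with rfl | h
    · rw [zero_mul] at hfx; linarith
    · exact h
  have hmin' : ∀ y ∈ Metric.closedBall xbar δ, (m : EReal) ≤ f y := fun y hy => by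
    rcases eq_or_ne y xbar with rfl | hy'
    · exact hm.ge
    · rw [← hm]; exact (hmin y ⟨hy, hy'⟩).le
  have hbound : ∀ y ∈ Metric.closedBall xbar δ, ‖y‖ ≤ ‖xbar‖ + δ := fun y hy => by
    rw [Metric.mem_closedBall, dist_eq_norm] at hy
    have := norm_add_le (y - xbar) xbar
    rw [sub_add_cancel] at this
    linarith
  -- an estimate for tilts attaining the minimum extends to all tilts by density
  have hstep : ∀ ξ : StrongDual ℝ X, ξ (x - xbar) - (a - m) ≤ κ * ‖ξ‖ ^ lam * ‖ξ‖ := by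
    intro ξ
    let D : Set (StrongDual ℝ X) :=
      {η | (argminOn (fun y => f y - ((η y : ℝ) : EReal)) (Metric.closedBall xbar δ)).Nonempty}
    have hD : Dense D := Metric.dense_iff.2 fun η r hr => by
      obtain ⟨η', h1, h2⟩ := exists_argminOn_near hX hbot hlsc Metric.isClosed_closedBall hbound
        hmin' ⟨xbar, hxbar, hfin⟩ η hr
      exact ⟨η', by rwa [Metric.mem_ball, dist_eq_norm], h2⟩
    have hclosed : IsClosed {η : StrongDual ℝ X |
        η (x - xbar) - (a - m) ≤ κ * ‖η‖ ^ lam * ‖η‖} := by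
      refine isClosed_le (by fun_prop) ?_
      exact (continuous_const.mul (continuous_norm.rpow_const fun _ => Or.inr hlam.le)).mul
        continuous_norm
    have hsub : D ⊆ {η : StrongDual ℝ X | η (x - xbar) - (a - m) ≤ κ * ‖η‖ ^ lam * ‖η‖} := by
      rintro η ⟨z, hz⟩
      have h1 := hz.2 x hx
      have h2 := htilt η z hz
      have h3 := hmin' z hz.1
      simp only [ha] at h1
      rw [← EReal.coe_sub] at h1
      have hzt : f z ≠ ⊤ := by
        intro h
        rw [h, EReal.top_sub_coe] at h1
        exact absurd h1 (not_le.2 (EReal.coe_lt_top _))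
      obtain ⟨b, hb⟩ : ∃ b : ℝ, f z = b := ⟨_, (EReal.coe_toReal hzt (hbot z)).symm⟩
      rw [hb, ← EReal.coe_sub, EReal.coe_le_coe_iff] at h1
      rw [hb, EReal.coe_le_coe_iff] at h3
      have h4 : η (z - xbar) ≤ ‖η‖ * ‖z - xbar‖ := (le_abs_self _).trans (η.le_opNorm _)
      have h5 : ‖η‖ * ‖z - xbar‖ ≤ ‖η‖ * (κ * ‖η‖ ^ lam) :=
        mul_le_mul_of_nonneg_left h2 (norm_nonneg _)
      simp only [mem_ofPred_eq]
      rw [map_sub] at h4 ⊢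
      linarith
    exact (hclosed.closure_subset_iff.2 hsub) (hD ξ)
  obtain ⟨g, hg1, hg2⟩ := exists_dual_vector ℝ (x - xbar) hd.ne'
  -- Doubling `L` leaves `L * ‖x - xbar‖` after subtracting `a - m ≤ L * ‖x - xbar‖`.
  have h1 := hstep ((2 * L) • g)
  rw [norm_smul, hg1, mul_one, Real.norm_of_nonneg (by positivity), smul_apply,
    smul_eq_mul, hg2, RCLike.ofReal_real_eq_id, id] at h1
  have h2 : L * ‖x - xbar‖ ≤ L * (2 * (κ * (2 * L) ^ lam)) := by linarith
  have h3 := le_of_mul_le_mul_left h2 hLpos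
  rw [Real.mul_rpow zero_le_two hL] at h3
  rw [Real.rpow_add two_pos, Real.rpow_one]
  linarith

/-! ### Lipschitz constants and slopes -/

theorem lipConst_neg_le (ξ : StrongDual ℝ X) :
    lipConst (fun y => -ξ y) ≤ ENNReal.ofReal ‖ξ‖ := by
  refine iSup_le fun x => iSup_le fun y => iSup_le fun hxy => ENNReal.ofReal_le_ofReal ?_
  rw [div_le_iff₀ (norm_pos_iff.2 (sub_ne_zero.2 hxy))]
  have h : -ξ x - -ξ y = -ξ (x - y) := by rw [map_sub]; ring
  rw [h, abs_neg]
  exact ξ.le_opNorm _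

theorem abs_sub_le_lipConst {E : Type*} [NormedAddCommGroup E] {ζ : E → ℝ} (hζ : IsLipschitzFun ζ) (x y : E) :
    |ζ x - ζ y| ≤ (lipConst ζ).toReal * ‖x - y‖ := by
  rcases eq_or_ne x y with rfl | hxy
  · simp
  have h : ENNReal.ofReal (|ζ x - ζ y| / ‖x - y‖) ≤ lipConst ζ :=
    le_iSup₂_of_le x y (le_iSup_of_le hxy le_rfl)
  have h2 := (ENNReal.ofReal_le_iff_le_toReal hζ.ne).1 h
  rwa [div_le_iff₀ (norm_pos_iff.2 (sub_ne_zero.2 hxy))] at h2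

theorem isConvexFun_neg (ξ : StrongDual ℝ X) :
    IsConvexFun fun y => ((-ξ y : ℝ) : EReal) := by
  refine ⟨fun x => EReal.coe_ne_bot _, fun x y a b _ _ _ => ?_⟩
  simp only
  rw [← EReal.coe_mul, ← EReal.coe_mul, ← EReal.coe_add, EReal.coe_le_coe_iff, map_add, map_smul,
    map_smul, smul_eq_mul, smul_eq_mul]
  linarith

theorem localSlope_neg_le (ξ : StrongDual ℝ X) (x : X) :
    localSlope (fun y => ((-ξ y : ℝ) : EReal)) x ≤ ENNReal.ofReal ‖ξ‖ := by
  rw [localSlope, if_neg (EReal.coe_ne_top _)]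
  refine limsup_le_of_le ⟨0, fun _ _ => zero_le⟩ ?_
  refine eventually_mem_nhdsWithin.mono fun y hy => ?_
  have hxy : 0 < ‖x - y‖ := norm_pos_iff.2 (sub_ne_zero.2 (Ne.symm hy))
  rw [← EReal.coe_sub, EReal.toENNReal_of_ne_top (EReal.coe_ne_top _), EReal.toReal_coe,
    ← ENNReal.ofReal_div_of_pos hxy]
  refine ENNReal.ofReal_le_ofReal ?_
  rw [div_le_iff₀ hxy]
  have h : -ξ x - -ξ y = -ξ (x - y) := by rw [map_sub]; ring
  rw [h]
  exact (neg_le_abs _).trans (ξ.le_opNorm _)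

/-- The difference quotients of a convex function are bounded by its slope. -/
theorem sub_le_localSlope {φ : X → EReal} (hφ : IsConvexFun φ) {x y : X} {a b : ℝ}
    (hx : φ x = a) (hy : φ y = b) (hS : localSlope φ x ≠ ⊤) :
    a - b ≤ (localSlope φ x).toReal * ‖y - x‖ := by
  rcases eq_or_ne y x with rfl | hne
  · rw [hx, EReal.coe_eq_coe_iff] at hy
    simp [hy]
  have hd : 0 < ‖y - x‖ := norm_pos_iff.2 (sub_ne_zero.2 hne)
  rw [← div_le_iff₀ hd]
  refine (ENNReal.ofReal_le_iff_le_toReal hS).1 ?_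
  rw [localSlope, if_neg (by rw [hx]; exact EReal.coe_ne_top _)]
  refine le_limsup_of_frequently_le ?_ ⟨⊤, by simp⟩
  -- Approaching `x` along the segment to `y`, convexity keeps the quotients at least `(a - b) / ‖y
  -- - x‖`; frequent lower bounds suffice for a limsup.
  have htend : Tendsto (fun t : ℝ => (1 - t) • x + t • y) (𝓝[>] 0) (𝓝[≠] x) := by
    refine tendsto_nhdsWithin_iff.2 ⟨?_, ?_⟩
    · have : Continuous fun t : ℝ => (1 - t) • x + t • y := by fun_prop
      have h := this.tendsto 0
      simp only [sub_zero, one_smul, zero_smul, add_zero] at h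
      exact h.mono_left nhdsWithin_le_nhds
    · refine eventually_mem_nhdsWithin.mono fun t ht h => ?_
      have h1 : t • (y - x) = 0 := by
        have h2 : (1 - t) • x + t • y = x + t • (y - x) := by module
        rwa [mem_singleton_iff, h2, add_eq_left] at h
      exact (smul_ne_zero (ne_of_gt ht) (sub_ne_zero.2 hne)) h1
  refine htend.frequently (Eventually.frequently ?_)
  filter_upwards [Ioo_mem_nhdsGT (zero_lt_one (α := ℝ))] with t ht
  have hconv := hφ.2 x y (1 - t) t (by linarith [ht.2]) ht.1 (by ring)
  rw [hx, hy, ← EReal.coe_mul, ← EReal.coe_mul, ← EReal.coe_add] at hconv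
  obtain ⟨c, hc⟩ : ∃ c : ℝ, φ ((1 - t) • x + t • y) = c :=
    ⟨_, (EReal.coe_toReal (hconv.trans_lt (EReal.coe_lt_top _)).ne (hφ.1 _)).symm⟩
  rw [hc, EReal.coe_le_coe_iff] at hconv
  have hnorm : ‖x - ((1 - t) • x + t • y)‖ = t * ‖y - x‖ := by
    have h2 : x - ((1 - t) • x + t • y) = -(t • (y - x)) := by module
    rw [h2, norm_neg, norm_smul, Real.norm_of_nonneg ht.1.le]
  have htd : 0 < t * ‖y - x‖ := mul_pos ht.1 hd
  rw [hx, hc, hnorm, ← EReal.coe_sub, EReal.toENNReal_of_ne_top (EReal.coe_ne_top _),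
    EReal.toReal_coe, ← ENNReal.ofReal_div_of_pos htd]
  refine ENNReal.ofReal_le_ofReal ?_
  rw [div_le_div_iff₀ hd htd]
  have : t * (a - b) ≤ a - c := by linarith
  nlinarith

end TiltStability

/-! ### The equivalence -/

theorem corollary1p2 {X : Type*} [NormedAddCommGroup X] [NormedSpace ℝ X]
    (hX : TiltStability.IsReflexiveSpace X)
    (f : X → EReal) (hf : TiltStability.IsProper f) (hlsc : LowerSemicontinuous f)
    (xbar : X) (δ : ℝ) (hδ : 0 < δ)
    (hmin : ∀ x ∈ Metric.closedBall xbar δ \ {xbar}, f xbar < f x)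
    (lam : ℝ) (hlam : 0 < lam) :
    List.TFAE [
      -- linear tilts
      ∃ κ : ℝ, 0 < κ ∧ ∀ (ξ : StrongDual ℝ X) (x : X),
        x ∈ TiltStability.argminOn (fun y => f y - ((ξ y : ℝ) : EReal))
          (Metric.closedBall xbar δ) →
        ‖x - xbar‖ ≤ κ * ‖ξ‖ ^ lam,
      -- Lipschitz perturbations
      ∃ κ : ℝ, 0 < κ ∧ ∀ ζ : X → ℝ, TiltStability.IsLipschitzFun ζ → ∀ x : X,
        x ∈ TiltStability.argminOn (fun y => f y + ((ζ y : ℝ) : EReal))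
          (Metric.closedBall xbar δ) →
        ‖x - xbar‖ ≤ κ * (TiltStability.lipConst ζ).toReal ^ lam,
      -- convex perturbations; the inequality is in `[0, +∞]`
      ∃ κ : ℝ, 0 < κ ∧ ∀ φ : X → EReal, TiltStability.IsConvexFun φ → ∀ x : X,
        x ∈ TiltStability.argminOn (fun y => f y + φ y) (Metric.closedBall xbar δ) →
        ENNReal.ofReal ‖x - xbar‖ ≤
          ENNReal.ofReal κ * TiltStability.localSlope φ xbar ^ lam] := by
  open TiltStability in
  have hxbar : xbar ∈ Metric.closedBall xbar δ := Metric.mem_closedBall_self hδ.le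
  have hfin : f xbar ≠ ⊤ := by
    -- Strict minimality gives finiteness only if the ball has a second point; otherwise properness
    -- does.
    rcases subsingleton_or_nontrivial X with _ | _
    · obtain ⟨x, hx⟩ := hf.2
      rwa [Subsingleton.elim xbar x]
    · obtain ⟨v, hv⟩ := exists_norm_eq X hδ.le
      have hmem : xbar + v ∈ Metric.closedBall xbar δ \ {xbar} := by
        refine ⟨by rw [Metric.mem_closedBall, dist_eq_norm, add_sub_cancel_left, hv], ?_⟩
        rw [mem_singleton_iff, add_eq_left, ← norm_eq_zero, hv]
        exact hδ.ne'
      exact (hmin _ hmem).ne_top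
  obtain ⟨m, hm⟩ : ∃ m : ℝ, f xbar = m := ⟨_, (EReal.coe_toReal hfin (hf.1 xbar)).symm⟩
  tfae_have 1 → 2 := by
    rintro ⟨κ, hκ, h⟩
    refine ⟨2 ^ (1 + lam) * κ, by positivity, fun ζ hζ x hx => ?_⟩
    refine norm_sub_le_of_tilt_stable hX hf.1 hlsc hδ hfin hmin hlam hκ h hx.1
      ENNReal.toReal_nonneg ?_
    have h1 := hx.2 xbar hxbar
    simp only [hm] at h1 ⊢
    rw [← EReal.coe_add] at h1
    have hfxt : f x ≠ ⊤ := by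
      intro ht
      rw [ht, EReal.top_add_coe] at h1
      exact absurd h1 (not_le.2 (EReal.coe_lt_top _))
    obtain ⟨a, ha⟩ : ∃ a : ℝ, f x = a := ⟨_, (EReal.coe_toReal hfxt (hf.1 x)).symm⟩
    rw [ha, ← EReal.coe_add, EReal.coe_le_coe_iff] at h1
    rw [ha, ← EReal.coe_add, EReal.coe_le_coe_iff]
    have h2 := (abs_le.1 (abs_sub_le_lipConst hζ x xbar)).1
    linarith
  tfae_have 2 → 1 := by
    rintro ⟨κ, hκ, h⟩
    refine ⟨κ, hκ, fun ξ x hx => ?_⟩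
    have hle := lipConst_neg_le ξ
    have hx' := h (fun y => -ξ y) (hle.trans_lt ENNReal.ofReal_lt_top) x (by
      simpa only [sub_eq_add_neg, EReal.coe_neg] using hx)
    refine hx'.trans ?_
    gcongr
    exact ENNReal.toReal_le_of_le_ofReal (norm_nonneg _) hle
  tfae_have 1 → 3 := by
    rintro ⟨κ, hκ, h⟩
    refine ⟨2 ^ (1 + lam) * κ, by positivity, fun φ hφ x hx => ?_⟩
    by_cases hS : localSlope φ xbar = ⊤
    · rw [hS, ENNReal.top_rpow_of_pos hlam, ENNReal.mul_top]
      · exact le_top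
      · exact (ENNReal.ofReal_pos.2 (by positivity)).ne'
    have hφbar : φ xbar ≠ ⊤ := fun ht => hS (by rw [localSlope, if_pos ht])
    obtain ⟨p, hp⟩ : ∃ p : ℝ, φ xbar = p := ⟨_, (EReal.coe_toReal hφbar (hφ.1 xbar)).symm⟩
    have h1 := hx.2 xbar hxbar
    simp only [hm, hp] at h1
    rw [← EReal.coe_add] at h1
    have hfxt : f x ≠ ⊤ := by
      intro ht
      rw [ht, EReal.top_add_of_ne_bot (hφ.1 x)] at h1
      exact absurd h1 (not_le.2 (EReal.coe_lt_top _))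
    have hφxt : φ x ≠ ⊤ := by
      intro ht
      rw [ht, EReal.add_top_of_ne_bot (hf.1 x)] at h1
      exact absurd h1 (not_le.2 (EReal.coe_lt_top _))
    obtain ⟨a, ha⟩ : ∃ a : ℝ, f x = a := ⟨_, (EReal.coe_toReal hfxt (hf.1 x)).symm⟩
    obtain ⟨q, hq⟩ : ∃ q : ℝ, φ x = q := ⟨_, (EReal.coe_toReal hφxt (hφ.1 x)).symm⟩
    rw [ha, hq, ← EReal.coe_add, EReal.coe_le_coe_iff] at h1
    have h2 := sub_le_localSlope hφ hp hq hS
    have h3 := norm_sub_le_of_tilt_stable hX hf.1 hlsc hδ hfin hmin hlam hκ h hx.1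
      (L := (localSlope φ xbar).toReal) ENNReal.toReal_nonneg (by
        rw [ha, hm, ← EReal.coe_add, EReal.coe_le_coe_iff]
        linarith)
    refine (ENNReal.ofReal_le_ofReal h3).trans_eq ?_
    rw [ENNReal.ofReal_mul (by positivity), ENNReal.toReal_rpow, ENNReal.ofReal_toReal]
    exact ENNReal.rpow_ne_top_of_nonneg hlam.le hS
  tfae_have 3 → 1 := by
    rintro ⟨κ, hκ, h⟩
    refine ⟨κ, hκ, fun ξ x hx => ?_⟩
    have hx' := h (fun y => ((-ξ y : ℝ) : EReal)) (isConvexFun_neg ξ) x (by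
      simpa only [sub_eq_add_neg, EReal.coe_neg] using hx)
    rw [← ENNReal.ofReal_le_ofReal_iff (by positivity), ENNReal.ofReal_mul hκ.le,
      ← ENNReal.ofReal_rpow_of_nonneg (norm_nonneg _) hlam.le]
    refine hx'.trans ?_
    gcongr
    exact localSlope_neg_le ξ xbar
  tfae_finish
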